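/- Let $A$ be a finite set, $F(A)$ the free group on $A$ and $\widehat F(A)$ the free profinite group on $A$, i.e. the profinite completion of $F(A)$. Let $\varphi$ be an endomorphism of $F(A)$ and let $\widehat\varphi$ be its unique continuous extension to $\widehat F(A)$. The continuous endomorphisms of $\widehat F(A)$, with composition and the compact-open topology, form a compact Hausdorff monoid; let $\widehat\varphi^{\,\omega}$ denote the unique idempotent in the closure of $\{\widehat\varphi^{\,n} : n\ge 1\}$. Let $M(\varphi)\in\mathbb Z^{A\times A}$ be the incidence matrix of $\varphi$, with entries $M(\varphi)_{a,b}=|\varphi(a)|_b$, where $|\cdot|_b\colon F(A)\to\mathbb Z$ is the homomorphism with $|b|_b=1$ and $|a|_b=0$ for all $a\in A\setminus\{b\}$. Let $G$ be a profinite group that has the $\omega$-presentation defined by $\varphi$, that is, $G$ is isomorphic, as a topological group, to $$\langle A \mid \widehat\varphi^{\,\omega}(a)a^{-1}\ (a\in A)\rangle=\widehat F(A)/N,$$ where $N$ is the closed normal subgroup of $\widehat F(A)$ generated by the elements $\widehat\varphi^{\,\omega}(a)a^{-1}$, $a\in A$. Suppose that $\det M(\varphi)\neq 0$. Then $G$ is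 a free profinite group if and only if $\varphi$ is an automorphism of $F(A)$. Here a profinite group $G$ is called free if it has a subset $X$ converging to $1$ (every neighbourhood of $1$ contains all but finitely many elements of $X$) such that every map $f\colon X\to H$ to a profinite group $H$ that converges to $1$ (for every neighbourhood $U$ of $1$ in $H$, $f(x)\in U$ for all but finitely many $x\in X$) extends uniquely to a continuous homomorphism $G\to H$. -/

import Mathlib

open CategoryTheory Filter Topology

universe u v

/-! ### The idempotent power in a compact monoid -/

/-- In a compact Hausdorff topological monoid, the closure of the set of powers `x ^ n`, `n ≥ 1`,
contains exactly one idempotent. -/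
theorem existsUnique_idempotent_mem_closure_powers {M : Type u} [Monoid M] [TopologicalSpace M]
    [CompactSpace M] [T2Space M] [ContinuousMul M] (x : M) :
    ∃! e : M, e ∈ closure {y : M | ∃ n : ℕ, 1 ≤ n ∧ y = x ^ n} ∧ e * e = e := by
  set S : Set M := {y : M | ∃ n : ℕ, 1 ≤ n ∧ y = x ^ n} with hS
  have hcomp : IsCompact (closure S) := isClosed_closure.isCompact
  have hmul : ∀ y ∈ closure S, ∀ z ∈ closure S, y * z ∈ closure S := by
    intro y hy z hz
    refine map_mem_closure₂ continuous_mul hy hz ?_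
    rintro _ ⟨m, hm, rfl⟩ _ ⟨n, hn, rfl⟩
    exact ⟨m + n, by omega, (pow_add x m n).symm⟩
  have hcommS : ∀ y ∈ S, ∀ z ∈ closure S, y * z = z * y := by
    rintro _ ⟨m, hm, rfl⟩ z hz
    have hcl : IsClosed {z : M | x ^ m * z = z * x ^ m} :=
      isClosed_eq (by fun_prop) (by fun_prop)
    refine closure_minimal ?_ hcl hz
    rintro _ ⟨n, hn, rfl⟩
    exact pow_mul_comm x m n
  have hcomm : ∀ y ∈ closure S, ∀ z ∈ closure S, y * z = z * y := by
    intro y hy z hz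
    have hcl : IsClosed {y : M | y * z = z * y} := isClosed_eq (by fun_prop) (by fun_prop)
    exact closure_minimal (fun w hw => hcommS w hw z hz) hcl hy
  have hpow : ∀ e : M, e * e = e → ∀ n : ℕ, 1 ≤ n → e ^ n = e := by
    intro e he n hn
    induction n, hn using Nat.le_induction with
    | base => exact pow_one e
    | succ n _ ih => rw [pow_succ, ih, he]
  -- An idempotent of `closure S` is a multiple of every element of `closure S`.
  have hdiv : ∀ e ∈ closure S, e * e = e → ∀ y ∈ closure S, ∃ t ∈ closure S, y * t = e := by
    intro e heS he y hy
    have hcl : IsClosed {y : M | ∃ t ∈ closure S, y * t = e} := by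
      have h1 : IsClosed (((fun p : M × M => p.1 * p.2) ⁻¹' {e}) ∩
          (Prod.snd ⁻¹' closure S : Set (M × M))) :=
        (isClosed_singleton.preimage continuous_mul).inter
          (isClosed_closure.preimage continuous_snd)
      have h2 := (isClosedMap_fst_of_compactSpace (X := M) (Y := M)) _ h1
      convert h2 using 1
      ext y
      constructor
      · rintro ⟨t, ht, h⟩
        exact ⟨(y, t), ⟨h, ht⟩, rfl⟩
      · rintro ⟨⟨y', t⟩, ⟨h, ht⟩, rfl⟩
        exact ⟨t, ht, h⟩
    refine closure_minimal ?_ hcl hy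
    rintro _ ⟨m, hm, rfl⟩
    -- `e = e ^ (m + 1)` is a limit of the elements `x ^ m * x ^ (n * (m + 1) - m)`.
    have hK : IsClosed ((fun t => x ^ m * t) '' closure S) :=
      (hcomp.image (by fun_prop)).isClosed
    have hmem : e ^ (m + 1) ∈ (fun t => x ^ m * t) '' closure S := by
      have hcl' : IsClosed ((fun z : M => z ^ (m + 1)) ⁻¹' ((fun t => x ^ m * t) '' closure S)) :=
        hK.preimage (by fun_prop)
      refine closure_minimal ?_ hcl' heS
      rintro _ ⟨n, hn, rfl⟩
      refine ⟨x ^ (n * (m + 1) - m), subset_closure ⟨n * (m + 1) - m, ?_, rfl⟩, ?_⟩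
      · have : m + 1 ≤ n * (m + 1) := Nat.le_mul_of_pos_left _ hn
        omega
      · have : m + 1 ≤ n * (m + 1) := Nat.le_mul_of_pos_left _ hn
        change x ^ m * x ^ (n * (m + 1) - m) = (x ^ n) ^ (m + 1)
        rw [← pow_add, ← pow_mul]
        congr 1
        omega
    rw [hpow e he (m + 1) (by omega)] at hmem
    obtain ⟨t, ht, h⟩ := hmem
    exact ⟨t, ht, h⟩
  obtain ⟨e, heS, he⟩ := exists_idempotent_in_compact_subsemigroup
    (fun r : M => continuous_mul_const r) (closure S)
    ⟨x, subset_closure ⟨1, le_rfl, (pow_one x).symm⟩⟩ hcomp hmul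
  refine ⟨e, ⟨heS, he⟩, ?_⟩
  rintro f ⟨hfS, hf⟩
  obtain ⟨t, ht, h1⟩ := hdiv e heS he f hfS
  obtain ⟨s, hs, h2⟩ := hdiv f hfS hf e heS
  have h3 : f * e = e := by rw [← h1, ← mul_assoc, hf]
  have h4 : e * f = f := by rw [← h2, ← mul_assoc, he]
  rw [← h4, hcomm e heS f hfS, h3]

/-- The `ω`-power `x ^ ω` of an element `x` of a compact Hausdorff topological monoid: the unique
idempotent in the closure of `{x ^ n | n ≥ 1}`. -/
noncomputable def omegaPower {M : Type u} [Monoid M] [TopologicalSpace M]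
    [CompactSpace M] [T2Space M] [ContinuousMul M] (x : M) : M :=
  (existsUnique_idempotent_mem_closure_powers x).choose

/-! ### Continuous endomorphisms -/

/-- The continuous endomorphisms of a profinite group. -/
def ContEnd (P : ProfiniteGrp.{u}) : Type u := P →ₜ* P

namespace ContEnd

/-- The compact-open topology. -/
instance (P : ProfiniteGrp.{u}) : TopologicalSpace (ContEnd P) :=
  inferInstanceAs (TopologicalSpace (ContinuousMonoidHom P P))

instance (P : ProfiniteGrp.{u}) : T2Space (ContEnd P) :=
  inferInstanceAs (T2Space (ContinuousMonoidHom P P))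

instance (P : ProfiniteGrp.{u}) : FunLike (ContEnd P) P P :=
  inferInstanceAs (FunLike (P →ₜ* P) P P)

instance (P : ProfiniteGrp.{u}) : MonoidHomClass (ContEnd P) P P :=
  inferInstanceAs (MonoidHomClass (P →ₜ* P) P P)

instance (P : ProfiniteGrp.{u}) : ContinuousMapClass (ContEnd P) P P :=
  inferInstanceAs (ContinuousMapClass (P →ₜ* P) P P)

/-- Multiplication of endomorphisms is composition, `(f * g) x = f (g x)`. -/
instance (P : ProfiniteGrp.{u}) : Monoid (ContEnd P) where
  mul f g := ContinuousMonoidHom.comp f g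
  one := ContinuousMonoidHom.id P
  mul_assoc _ _ _ := rfl
  one_mul _ := rfl
  mul_one _ := rfl

instance (P : ProfiniteGrp.{u}) : ContinuousMul (ContEnd P) where
  continuous_mul :=
    (ContinuousMonoidHom.continuous_comp (A := P) (B := P) (C := P)).comp continuous_swap

end ContEnd

/-! ### Free profinite groups -/

/-- The free profinite group on a finite set `A`: the profinite completion of the free group
on `A`. -/
noncomputable def FreeProfinite (A : Type v) : ProfiniteGrp.{v} :=
  ProfiniteGrp.profiniteCompletion.obj (GrpCat.of (FreeGroup A))

namespace FreeProfinite

/-- The canonical homomorphism from the free group to the free profinite group. -/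
noncomputable def eta (A : Type v) : FreeGroup A →* FreeProfinite A :=
  (ProfiniteGrp.ProfiniteCompletion.eta (GrpCat.of (FreeGroup A))).hom

/-- The letter `a`, as an element of the free profinite group. -/
noncomputable def of {A : Type v} (a : A) : FreeProfinite A := eta A (FreeGroup.of a)

/-- The profinite extension of an endomorphism of the free group. -/
noncomputable def extend {A : Type v} (φ : FreeGroup A →* FreeGroup A) :
    ContEnd (FreeProfinite A) :=
  (ProfiniteGrp.profiniteCompletion.map (GrpCat.ofHom φ)).hom

theorem extend_eta {A : Type v} (φ : FreeGroup A →* FreeGroup A) (w : FreeGroup A) :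
    extend φ (eta A w) = eta A (φ w) :=
  ConcreteCategory.congr_hom (ProfiniteGrp.ProfiniteCompletion.lift_eta
    (GrpCat.ofHom φ ≫ ProfiniteGrp.ProfiniteCompletion.eta (GrpCat.of (FreeGroup A)))) w

theorem denseRange_eta (A : Type v) : DenseRange (eta A) :=
  ProfiniteGrp.ProfiniteCompletion.denseRange (GrpCat.of (FreeGroup A))

/-- The continuous endomorphism with prescribed values on the letters. -/
noncomputable def endOfTuple {A : Type v} (t : A → FreeProfinite A) : ContEnd (FreeProfinite A) :=
  (ProfiniteGrp.ProfiniteCompletion.lift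
    (GrpCat.ofHom (FreeGroup.lift t) : GrpCat.of (FreeGroup A) ⟶ GrpCat.of (FreeProfinite A))).hom

theorem endOfTuple_eta {A : Type v} (t : A → FreeProfinite A) (w : FreeGroup A) :
    endOfTuple t (eta A w) = FreeGroup.lift t w :=
  ConcreteCategory.congr_hom (ProfiniteGrp.ProfiniteCompletion.lift_eta
    (GrpCat.ofHom (FreeGroup.lift t) : GrpCat.of (FreeGroup A) ⟶ GrpCat.of (FreeProfinite A))) w

theorem continuous_endOfTuple (A : Type v) [Finite A] :
    Continuous (endOfTuple : (A → FreeProfinite A) → ContEnd (FreeProfinite A)) := by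
  refine ContinuousMonoidHom.continuous_of_continuous_uncurry (B := FreeProfinite A)
    (C := FreeProfinite A) endOfTuple ?_
  rw [continuous_iff_continuousAt]
  rintro ⟨t, x⟩ W hW
  change W ∈ 𝓝 (endOfTuple t x) at hW
  have hV : (fun z => endOfTuple t x * z) ⁻¹' W ∈ 𝓝 (1 : FreeProfinite A) :=
    (continuous_const_mul (endOfTuple t x)).continuousAt (by simpa using hW)
  obtain ⟨V, hVW, hVo, hV1⟩ := mem_nhds_iff.mp hV
  obtain ⟨N, hN⟩ := ProfiniteGrp.exist_openNormalSubgroup_sub_open_nhds_of_one hVo hV1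
  have hNo : IsOpen (N : Set (FreeProfinite A)) := N.isOpen'
  have hNc : IsClosed (N : Set (FreeProfinite A)) := N.toOpenSubgroup.isClosed
  have h1 : ∀ᶠ t' in 𝓝 t, ∀ a, (t a)⁻¹ * t' a ∈ (N : Set (FreeProfinite A)) := by
    rw [eventually_all]
    intro a
    have hc : Continuous fun t' : A → FreeProfinite A => (t a)⁻¹ * t' a := by fun_prop
    exact hc.continuousAt (hNo.mem_nhds (by simp))
  have h2 : ∀ᶠ x' in 𝓝 x,
      (endOfTuple t x)⁻¹ * endOfTuple t x' ∈ (N : Set (FreeProfinite A)) := by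
    have hc : Continuous fun x' => (endOfTuple t x)⁻¹ * endOfTuple t x' :=
      (map_continuous (endOfTuple t)).const_mul _
    exact hc.continuousAt (hNo.mem_nhds (by simp))
  have h3 := h1.prod_nhds h2
  refine mem_map.mpr ?_
  filter_upwards [h3]
  rintro ⟨t', x'⟩ ⟨ht, hx⟩
  have hN' : N.toSubgroup.Normal := N.isNormal'
  -- Tuples that agree modulo `N` give endomorphisms that agree modulo `N`.
  have hq : (QuotientGroup.mk' N.toSubgroup).comp (FreeGroup.lift t) =
      (QuotientGroup.mk' N.toSubgroup).comp (FreeGroup.lift t') := by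
    ext a
    simpa using QuotientGroup.eq.mpr (ht a)
  have hall : ∀ y, (endOfTuple t y)⁻¹ * endOfTuple t' y ∈ (N : Set (FreeProfinite A)) := by
    have hcl : IsClosed {y | (endOfTuple t y)⁻¹ * endOfTuple t' y ∈ (N : Set (FreeProfinite A))} :=
      hNc.preimage ((map_continuous (endOfTuple t)).inv.mul (map_continuous (endOfTuple t')))
    intro y
    refine (denseRange_eta A).induction_on (p := fun y => (endOfTuple t y)⁻¹ * endOfTuple t' y ∈
      (N : Set (FreeProfinite A))) y hcl ?_
    intro w
    rw [endOfTuple_eta, endOfTuple_eta]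
    exact QuotientGroup.eq.mp (DFunLike.congr_fun hq w)
  have hmem : (endOfTuple t x)⁻¹ * endOfTuple t' x' ∈ (N : Set (FreeProfinite A)) := by
    have := N.mul_mem hx (hall x')
    rwa [mul_assoc, mul_inv_cancel_left] at this
  have := hVW (hN hmem)
  change endOfTuple t x * ((endOfTuple t x)⁻¹ * endOfTuple t' x') ∈ W at this
  rw [mul_inv_cancel_left] at this
  exact this

/-- The continuous endomorphisms of a free profinite group of finite rank form a compact monoid. -/
instance (A : Type v) [Finite A] : CompactSpace (ContEnd (FreeProfinite A)) := by
  refine Function.Surjective.compactSpace (f := endOfTuple) (continuous_endOfTuple A) ?_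
  intro ψ
  refine ⟨fun a => ψ (of a), ?_⟩
  apply DFunLike.coe_injective
  refine (denseRange_eta A).equalizer (map_continuous _) (map_continuous _) ?_
  funext w
  change endOfTuple _ (eta A w) = ψ (eta A w)
  rw [endOfTuple_eta]
  have h : FreeGroup.lift (fun a => ψ (of a)) =
      (ψ : FreeProfinite A →* FreeProfinite A).comp (eta A) := by
    ext a
    simp [of]
  rw [h]
  rfl

end FreeProfinite

/-- A profinite group `G` is free if it has a basis: a subset `X` converging to `1` (every
neighbourhood of `1` contains all but finitely many elements of `X`) such that every map from `X`
to a profinite group that converges to `1` extends uniquely to a continuous homomorphism on `G`.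
Convergence to `1` is automatic for finite `X`. -/
def IsFreeProfinite (G : ProfiniteGrp.{u}) : Prop :=
  ∃ X : Set G, Tendsto (fun x : X => (x : G)) cofinite (𝓝 1) ∧
    ∀ (H : ProfiniteGrp.{u}) (f : X → H), Tendsto f cofinite (𝓝 1) →
      ∃! F : G →ₜ* H, ∀ x : X, F (x : G) = f x

/-! ### Presentations -/

/-- The closed normal subgroup generated by a subset of a profinite group. -/
def closedNormalClosure {P : ProfiniteGrp.{u}} (R : Set P) : Subgroup P :=
  (Subgroup.normalClosure R).topologicalClosure

instance {P : ProfiniteGrp.{u}} (R : Set P) : (closedNormalClosure R).Normal :=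
  Subgroup.is_normal_topologicalClosure _

/-- `G` has the profinite presentation `⟨A ∣ R⟩`. -/
def HasProfinitePresentation (G : ProfiniteGrp.{u}) (A : Type v) (R : Set (FreeProfinite A)) :
    Prop :=
  Nonempty (G ≃ₜ* (FreeProfinite A ⧸ closedNormalClosure R))

/-- The endomorphism `φ` of the free group on `A` defines an `ω`-presentation of `G`, that is,
`G ≅ ⟨A ∣ ψ(a) a⁻¹ (a ∈ A)⟩`, where `ψ` is the `ω`-power of the profinite extension of `φ`. -/
def DefinesOmegaPresentation {A : Type v} [Finite A] (φ : FreeGroup A →* FreeGroup A)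
    (G : ProfiniteGrp.{u}) : Prop :=
  HasProfinitePresentation G A
    (Set.range fun a : A =>
      omegaPower (FreeProfinite.extend φ) (FreeProfinite.of a) * (FreeProfinite.of a)⁻¹)

/-! ### The incidence matrix -/

/-- The homomorphism from the free group to `ℤ` that sends the letter `b` to `1` and every other
letter to `0`. -/
def letterCount {A : Type v} [DecidableEq A] (b : A) : FreeGroup A →* Multiplicative ℤ :=
  FreeGroup.lift fun a => Multiplicative.ofAdd (if a = b then 1 else 0)

/-- The incidence matrix of an endomorphism of the free group. -/
def incidenceMatrix {A : Type v} [DecidableEq A] (φ : FreeGroup A →* FreeGroup A) :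
    Matrix A A ℤ :=
  Matrix.of fun a b => (letterCount b (φ (FreeGroup.of a))).toAdd

-- Let ψ be the ω-power of the extension of φ. In a compact monoid ψ = 1 exactly when that extension
-- is a unit, and this happens exactly when φ is bijective: a unit forces bijectivity because
-- finitely generated subgroups of a free group are closed in the profinite topology
-- (`FreeGroup.exists_finite_perm_separating`). If ψ = 1, the relators vanish and the letters give a
-- basis of G.
--
-- Conversely, let G be free on X, and count homomorphisms. X is finite, so a finite group K
-- receives |K|^|X| of them from G. For a prime p not dividing the determinant, φ permutes the
-- homomorphisms F(A) → ℤ/p, so the idempotent ψ fixes them all (`lift_omegaPower_of_injective`).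
-- They therefore all factor through G, whence p^|X| = p^|A| and |X| = |A|. Now for every finite K
-- the injection Hom(G, K) → K^A is a bijection by cardinality. So every finite quotient of the free
-- profinite group factors through G; the relators die in all of them and are trivial, that is, ψ =
-- 1.

universe w

/-! ### Idempotent powers and units -/

section OmegaPower

variable {M : Type u} [Monoid M] [TopologicalSpace M] [CompactSpace M] [T2Space M]
  [ContinuousMul M] (x : M)

theorem omegaPower_mem_closure : omegaPower x ∈ closure {y : M | ∃ n : ℕ, 1 ≤ n ∧ y = x ^ n} :=
  (existsUnique_idempotent_mem_closure_powers x).choose_spec.1.1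

theorem omegaPower_mul_self : omegaPower x * omegaPower x = omegaPower x :=
  (existsUnique_idempotent_mem_closure_powers x).choose_spec.1.2

/-- The `ω`-power of a unit is trivial. -/
theorem omegaPower_eq_one {x : M} (hx : IsUnit x) : omegaPower x = 1 := by
  -- By compactness right invertibility passes to limits of powers of `x`; a right invertible
  -- idempotent is 1.
  have hcl : IsClosed {y : M | ∃ t, y * t = 1} := by
    have h := (isClosedMap_fst_of_compactSpace (X := M) (Y := M)) {p | p.1 * p.2 = 1}
      (isClosed_eq (by fun_prop) (by fun_prop))
    convert h using 1
    ext y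
    simp
  have hmem : ∃ t, omegaPower x * t = 1 := by
    refine closure_minimal ?_ hcl (omegaPower_mem_closure x)
    rintro _ ⟨n, -, rfl⟩
    exact (hx.pow n).exists_right_inv
  obtain ⟨t, ht⟩ := hmem
  calc omegaPower x = omegaPower x * (omegaPower x * t) := by rw [ht, mul_one]
    _ = 1 := by rw [← mul_assoc, omegaPower_mul_self, ht]

/-- An element whose `ω`-power is trivial is a unit. -/
theorem isUnit_of_omegaPower_eq_one {x : M} (hx : omegaPower x = 1) : IsUnit x := by
  -- The compact set xM is closed and contains every xⁿ with n ≥ 1, hence also the ω-power 1.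
  have hr : (1 : M) ∈ Set.range (fun t => x * t) := by
    rw [← hx]
    refine closure_minimal ?_ (isCompact_range (by fun_prop)).isClosed (omegaPower_mem_closure x)
    rintro _ ⟨n, hn, rfl⟩
    exact ⟨x ^ (n - 1), by simp only [← pow_succ', Nat.sub_add_cancel hn]⟩
  have hl : (1 : M) ∈ Set.range (fun t => t * x) := by
    rw [← hx]
    refine closure_minimal ?_ (isCompact_range (by fun_prop)).isClosed (omegaPower_mem_closure x)
    rintro _ ⟨n, hn, rfl⟩
    exact ⟨x ^ (n - 1), by simp only [← pow_succ, Nat.sub_add_cancel hn]⟩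
  obtain ⟨s, hs⟩ := hr
  obtain ⟨t, ht⟩ := hl
  exact isUnit_iff_exists_and_exists.mpr ⟨⟨s, hs⟩, ⟨t, ht⟩⟩

end OmegaPower

/-! ### The universal property of the free profinite group, across universes -/

namespace FreeProfinite

variable {A : Type v}

theorem hom_ext {H : Type w} [Group H] [TopologicalSpace H] [T2Space H]
    {F F' : FreeProfinite A →ₜ* H} (h : ∀ a, F (of a) = F' (of a)) : F = F' := by
  apply DFunLike.coe_injective
  refine (denseRange_eta A).equalizer (map_continuous F) (map_continuous F') ?_
  funext w
  have : (F : FreeProfinite A →* H).comp (eta A) = (F' : FreeProfinite A →* H).comp (eta A) := by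
    ext a
    exact h a
  exact DFunLike.congr_fun this w

/-- Every subgroup of finite index of the free group is open in the profinite topology. -/
theorem exists_isOpen_preimage_eta_subset (K : Subgroup (FreeGroup A)) [K.Normal] [K.FiniteIndex] :
    ∃ V : Set (FreeProfinite A), IsOpen V ∧ 1 ∈ V ∧ ∀ w, eta A w ∈ V → w ∈ K := by
  let : TopologicalSpace (FreeGroup A ⧸ K) := ⊥
  have : DiscreteTopology (FreeGroup A ⧸ K) := ⟨rfl⟩
  let f : GrpCat.of (FreeGroup A) ⟶ GrpCat.of (ProfiniteGrp.of (FreeGroup A ⧸ K)) :=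
    GrpCat.ofHom (QuotientGroup.mk' K)
  let p : FreeProfinite A →ₜ* (FreeGroup A ⧸ K) := (ProfiniteGrp.ProfiniteCompletion.lift f).hom
  have hp : ∀ w, p (eta A w) = (w : FreeGroup A ⧸ K) := fun w =>
    ConcreteCategory.congr_hom (ProfiniteGrp.ProfiniteCompletion.lift_eta f) w
  refine ⟨p ⁻¹' {1}, (isOpen_discrete _).preimage (map_continuous p), map_one p, ?_⟩
  intro w hw
  rw [← QuotientGroup.eq_one_iff, ← hp]
  exact hw

variable {H : Type w} [Group H] [TopologicalSpace H] [IsTopologicalGroup H] [CompactSpace H]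
  [TotallyDisconnectedSpace H]

/-- A homomorphism from the free group to a profinite group extends continuously to the free
profinite group: the closure of its graph is the graph of the extension. -/
theorem exists_continuous_extension (f : FreeGroup A →* H) :
    ∃ F : FreeProfinite A →ₜ* H, ∀ w, F (eta A w) = f w := by
  let Γ : Subgroup (FreeProfinite A × H) := ((eta A).prod f).range.topologicalClosure
  have hΓ : IsClosed (Γ : Set (FreeProfinite A × H)) := Subgroup.isClosed_topologicalClosure _
  have hmem : ∀ w, (eta A w, f w) ∈ Γ := fun w =>
    Subgroup.le_topologicalClosure _ ⟨w, rfl⟩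
  have : CompactSpace Γ := isCompact_iff_compactSpace.mp hΓ.isCompact
  -- Once this projection is bijective, compactness makes its inverse continuous, and the second
  -- coordinate of the inverse is the extension.
  let p : Γ →* FreeProfinite A := (MonoidHom.fst _ _).comp Γ.subtype
  have hpc : Continuous p := continuous_fst.comp continuous_subtype_val
  have hinj : Function.Injective p := by
    rw [injective_iff_map_eq_one]
    rintro ⟨⟨y, h⟩, hyh⟩ hy
    obtain rfl : y = 1 := hy
    suffices h1 : h = 1 by subst h1; rfl
    by_contra hne
    -- A graph point close to (1, h) has f(w) in U, since f⁻¹(U) has finite index, and h f(w)⁻¹ in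
    -- U; so h would lie in U.
    obtain ⟨U, hU⟩ := ProfiniteGrp.exist_openNormalSubgroup_sub_open_nhds_of_one
      (G := H) (isOpen_compl_singleton (x := h)) (by simpa using Ne.symm hne)
    have : (U.toSubgroup.comap f).Normal := U.isNormal'.comap f
    have : (U.toSubgroup.comap f).FiniteIndex :=
      (U.toFiniteIndexNormalSubgroup.comap f).isFiniteIndex'
    obtain ⟨V, hVo, hV1, hV⟩ := exists_isOpen_preimage_eta_subset (U.toSubgroup.comap f)
    have hn : V ×ˢ ((fun z => h * z⁻¹) ⁻¹' (U : Set H)) ∈ 𝓝 ((1 : FreeProfinite A), h) := by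
      refine prod_mem_nhds (hVo.mem_nhds hV1) ?_
      have hc : Continuous fun z : H => h * z⁻¹ := by fun_prop
      exact hc.continuousAt (U.isOpen'.mem_nhds (by simp))
    obtain ⟨_, ⟨h2, h3⟩, w, rfl⟩ := mem_closure_iff_nhds.mp hyh _ hn
    have h4 : f w ∈ U := hV w h2
    have h5 : h * (f w)⁻¹ ∈ U := h3
    have h6 : h ∈ U := by
      have := U.mul_mem h5 h4
      rwa [inv_mul_cancel_right] at this
    exact hU h6 rfl
  have hsurj : Function.Surjective p := by
    intro y
    have hcl : IsClosed (Set.range p) := (isCompact_range hpc).isClosed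
    refine (denseRange_eta A).induction_on (p := fun y => y ∈ Set.range p) y hcl fun w => ?_
    exact ⟨⟨_, hmem w⟩, rfl⟩
  let e : Γ ≃ₜ FreeProfinite A :=
    Continuous.homeoOfEquivCompactToT2 (f := Equiv.ofBijective p ⟨hinj, hsurj⟩) hpc
  let e' : Γ ≃* FreeProfinite A := MulEquiv.ofBijective p ⟨hinj, hsurj⟩
  refine ⟨⟨((MonoidHom.snd _ _).comp Γ.subtype).comp e'.symm.toMonoidHom, ?_⟩, ?_⟩
  · exact (continuous_snd.comp continuous_subtype_val).comp e.symm.continuous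
  · intro w
    have : e'.symm (eta A w) = ⟨_, hmem w⟩ := (MulEquiv.symm_apply_eq e').mpr rfl
    change (e'.symm (eta A w)).1.2 = f w
    rw [this]

/-- The continuous homomorphism from the free profinite group with prescribed values on letters. -/
noncomputable def lift (c : A → H) : FreeProfinite A →ₜ* H :=
  (exists_continuous_extension (FreeGroup.lift c)).choose

theorem lift_eta (c : A → H) (w : FreeGroup A) : lift c (eta A w) = FreeGroup.lift c w :=
  (exists_continuous_extension (FreeGroup.lift c)).choose_spec w

@[simp]
theorem lift_of (c : A → H) (a : A) : lift c (of a) = c a := by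
  rw [of, lift_eta, FreeGroup.lift_apply_of]

end FreeProfinite

/-! ### Separability of finitely generated subgroups of free groups -/

namespace FreeGroup

variable {A : Type v}

/-- The action of a free group can be modified outside a finite set so that the set becomes
invariant, keeping the paths that stay inside the set. -/
theorem exists_perm_of_finite {Ω : Type w} (ρ : FreeGroup A →* Equiv.Perm Ω) (T : Set Ω)
    [Finite T] :
    ∃ θ : FreeGroup A →* Equiv.Perm T, ∀ (x : T) (L : List (A × Bool)),
      (∀ s, s <:+ L → ρ (mk s) x ∈ T) → (θ (mk L) x : Ω) = ρ (mk L) x := by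
  classical
  have := Fintype.ofFinite T
  -- The letter acts as a partial injection of the finite set `T`, which can be completed to a
  -- permutation.
  let σ (a : A) : {x : T // ρ (of a) x ∈ T} ≃ {x : T // (ρ (of a)).symm x ∈ T} :=
    { toFun := fun x => ⟨⟨ρ (of a) x.1, x.2⟩, by simp⟩
      invFun := fun x => ⟨⟨(ρ (of a)).symm x.1, x.2⟩, by simp⟩
      left_inv := fun x => by simp
      right_inv := fun x => by simp }
  have hσ : ∀ (a : A) (x : T), ρ (of a) x ∈ T → ((σ a).extendSubtype x : Ω) = ρ (of a) x := by
    intro a x hx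
    exact congrArg Subtype.val ((σ a).extendSubtype_apply_of_mem x hx)
  refine ⟨FreeGroup.lift fun a => (σ a).extendSubtype, fun x L => ?_⟩
  -- The rightmost letter acts first, so the vertices of the path are the images of `x` under
  -- suffixes.
  induction L with
  | nil => intro _; simp [← one_eq_mk]
  | cons l L ih =>
    intro h
    have ih := ih fun s hs => h s (hs.trans (List.suffix_cons l L))
    have hL := h _ (List.suffix_refl _)
    have hcons : (mk (l :: L) : FreeGroup A) = mk [l] * mk L := by simp [mul_mk]
    obtain ⟨a, b⟩ := l
    rw [hcons, _root_.map_mul, Equiv.Perm.mul_apply] at hL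
    rw [hcons, _root_.map_mul, _root_.map_mul, Equiv.Perm.mul_apply, Equiv.Perm.mul_apply, ← ih]
    rw [← ih] at hL
    generalize (FreeGroup.lift fun a => (σ a).extendSubtype) (mk L) x = y at hL ⊢
    cases b with
    | true =>
      have : (mk [(a, true)] : FreeGroup A) = of a := rfl
      rw [this] at hL ⊢
      rw [lift_apply_of]
      exact hσ a y hL
    | false =>
      have : (mk [(a, false)] : FreeGroup A) = (of a)⁻¹ := rfl
      rw [this, _root_.map_inv] at hL ⊢
      rw [_root_.map_inv, lift_apply_of]
      have h1 := (hσ a ⟨_, hL⟩ (by simp)).trans ((ρ (of a)).apply_symm_apply y)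
      have h2 : (σ a).extendSubtype ⟨_, hL⟩ = y := Subtype.ext h1
      exact congrArg Subtype.val ((σ a).extendSubtype.symm_apply_eq.mpr h2.symm)

/-- Finitely generated subgroups of free groups are separable. -/
theorem exists_finite_perm_separating (K : Subgroup (FreeGroup A)) (hK : K.FG) {g : FreeGroup A}
    (hg : g ∉ K) :
    ∃ (T : Type v) (_ : Finite T) (θ : FreeGroup A →* Equiv.Perm T) (t : T),
      (∀ k ∈ K, θ k t = t) ∧ θ g t ≠ t := by
  classical
  obtain ⟨S, rfl⟩ := hK
  let ρ : FreeGroup A →* Equiv.Perm (FreeGroup A ⧸ Subgroup.closure (S : Set (FreeGroup A))) :=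
    MulAction.toPermHom _ _
  let W : Finset (FreeGroup A) := insert 1 (insert g S)
  -- All cosets visited on the paths from the base coset spelled by `g` and the generators; the word
  -- 1 supplies the base coset.
  let T : Set (FreeGroup A ⧸ Subgroup.closure (S : Set (FreeGroup A))) :=
    ⋃ w ∈ W, ⋃ s ∈ w.toWord.tails.toFinset, {ρ (mk s) ((1 : FreeGroup A) : _ ⧸ _)}
  have hT : T.Finite := by
    refine Set.Finite.biUnion W.finite_toSet fun w _ => ?_
    exact Set.Finite.biUnion (Finset.finite_toSet _) fun s _ => Set.finite_singleton _
  have hmem : ∀ w ∈ W, ∀ s, s <:+ w.toWord → ρ (mk s) ((1 : FreeGroup A) : _ ⧸ _) ∈ T := by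
    intro w hw s hs
    simp only [T, Set.mem_iUnion]
    exact ⟨w, hw, s, by simpa using hs, rfl⟩
  have h1 : ((1 : FreeGroup A) : FreeGroup A ⧸ Subgroup.closure (S : Set (FreeGroup A))) ∈ T := by
    have := hmem 1 (by simp [W]) [] (by simp)
    rwa [← one_eq_mk, _root_.map_one] at this
  have : Finite T := hT
  obtain ⟨θ, hθ⟩ := exists_perm_of_finite ρ T
  have key : ∀ w ∈ W, θ w ⟨_, h1⟩ = ⟨_, h1⟩ ↔ w ∈ Subgroup.closure (S : Set (FreeGroup A)) := by
    intro w hw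
    have h2 := hθ ⟨_, h1⟩ w.toWord (hmem w hw)
    rw [mk_toWord] at h2
    rw [Subtype.ext_iff, h2]
    change ((w * 1 : FreeGroup A) : FreeGroup A ⧸ Subgroup.closure (S : Set (FreeGroup A))) =
      ((1 : FreeGroup A) : FreeGroup A ⧸ Subgroup.closure (S : Set (FreeGroup A))) ↔ _
    rw [mul_one, eq_comm, QuotientGroup.eq, inv_one, one_mul]
  refine ⟨T, inferInstance, θ, ⟨_, h1⟩, ?_, ?_⟩
  · intro k hk
    induction hk using Subgroup.closure_induction with
    | mem x hx => exact (key x (by simp [W, Finset.mem_coe.mp hx])).mpr (Subgroup.subset_closure hx)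
    | one => simp
    | mul x y _ _ hx hy => rw [_root_.map_mul, Equiv.Perm.mul_apply, hy, hx]
    | inv x _ hx => rw [_root_.map_inv, Equiv.Perm.inv_eq_iff_eq, hx]
  · exact fun h => hg ((key g (by simp [W])).mp h)

end FreeGroup

/-! ### Endomorphisms with trivial idempotent power -/

namespace FreeProfinite

variable {A : Type v}

theorem extend_mul (φ φ' : FreeGroup A →* FreeGroup A) :
    extend (φ.comp φ') = extend φ * extend φ' := by
  refine hom_ext fun a => ?_
  change extend (φ.comp φ') (eta A (FreeGroup.of a)) = extend φ (extend φ' (eta A (FreeGroup.of a)))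
  rw [extend_eta, extend_eta, extend_eta, MonoidHom.comp_apply]

theorem extend_id : extend (MonoidHom.id (FreeGroup A)) = 1 := by
  refine hom_ext fun a => ?_
  change extend (MonoidHom.id _) (eta A (FreeGroup.of a)) = eta A (FreeGroup.of a)
  rw [extend_eta, MonoidHom.id_apply]

theorem isUnit_extend {φ : FreeGroup A →* FreeGroup A} (hφ : Function.Bijective φ) :
    IsUnit (extend φ) := by
  let e : FreeGroup A ≃* FreeGroup A := MulEquiv.ofBijective φ hφ
  refine isUnit_iff_exists_and_exists.mpr
    ⟨⟨extend e.symm.toMonoidHom, ?_⟩, ⟨extend e.symm.toMonoidHom, ?_⟩⟩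
  · rw [← extend_mul, ← extend_id]
    congr 1
    ext1 a
    exact e.apply_symm_apply _
  · rw [← extend_mul, ← extend_id]
    congr 1
    ext1 a
    exact e.symm_apply_apply _

/-- An endomorphism of a free group of finite rank whose profinite extension is invertible is an
automorphism. -/
theorem bijective_of_isUnit_extend [Finite A] {φ : FreeGroup A →* FreeGroup A}
    (hφ : IsUnit (extend φ)) : Function.Bijective φ := by
  obtain ⟨⟨s, hs⟩, t, ht⟩ := isUnit_iff_exists_and_exists.mp hφ
  have hs' : ∀ x, extend φ (s x) = x := fun x => DFunLike.congr_fun hs x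
  have ht' : ∀ x, t (extend φ x) = x := fun x => DFunLike.congr_fun ht x
  -- The extension of `φ` is surjective, so no finite action can tell the image of `φ` from the
  -- whole group.
  have hext : ∀ {T : Type v} [Finite T] (θ : FreeGroup A →* Equiv.Perm T) (x : T),
      (∀ w, θ (φ w) x = x) → ∀ g, θ g x = x := by
    intro T _ θ x hx g
    let : TopologicalSpace (Equiv.Perm T) := ⊥
    have : DiscreteTopology (Equiv.Perm T) := ⟨rfl⟩
    obtain ⟨Θ, hΘ⟩ := exists_continuous_extension θ
    have hcl : IsClosed {y | Θ (extend φ y) x = x} :=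
      (isClosed_discrete {σ : Equiv.Perm T | σ x = x}).preimage
        ((map_continuous Θ).comp (map_continuous (extend φ)))
    have hall : ∀ y, Θ (extend φ y) x = x := fun y => by
      refine (denseRange_eta A).induction_on (p := fun y => Θ (extend φ y) x = x) y hcl fun w => ?_
      rw [extend_eta, hΘ]
      exact hx w
    rw [← hΘ, ← hs' (eta A g)]
    exact hall _
  constructor
  · rw [injective_iff_map_eq_one]
    intro g hg
    by_contra hne
    -- Separation from the trivial subgroup is residual finiteness; the left inverse `t` shows that
    -- `g` is trivial in the completion.
    obtain ⟨T, _, θ, x, -, hθ⟩ := FreeGroup.exists_finite_perm_separating ⊥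
      ⟨∅, by simp⟩ (g := g) (by simpa using hne)
    let : TopologicalSpace (Equiv.Perm T) := ⊥
    have : DiscreteTopology (Equiv.Perm T) := ⟨rfl⟩
    obtain ⟨Θ, hΘ⟩ := exists_continuous_extension θ
    apply hθ
    rw [← hΘ, ← ht' (eta A g), extend_eta, hg, map_one, map_one, map_one, Equiv.Perm.one_apply]
  · intro g
    by_contra hg
    obtain ⟨T, _, θ, x, hx, hθ⟩ := FreeGroup.exists_finite_perm_separating φ.range
      ((Group.fg_iff_subgroup_fg _).mp inferInstance) (g := g) (by simpa using hg)
    exact hθ (hext θ x (fun w => hx _ ⟨w, rfl⟩) g)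

/-- If precomposition with `φ` permutes the homomorphisms from the free group to a finite group
`K`, then the idempotent power of the extension of `φ` acts trivially on them. -/
theorem lift_omegaPower_of_injective [Finite A] (φ : FreeGroup A →* FreeGroup A) {K : Type w}
    [Group K] [Finite K] [TopologicalSpace K] [DiscreteTopology K]
    (hφ : Function.Injective fun (c : A → K) (a : A) => FreeGroup.lift c (φ (FreeGroup.of a)))
    (c : A → K) (a : A) : lift c (omegaPower (extend φ) (of a)) = c a := by
  set T : (A → K) → (A → K) := fun c a => FreeGroup.lift c (φ (FreeGroup.of a)) with hT
  set ψ := omegaPower (extend φ) with hψ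
  have hcomp : ∀ (c : A → K) (x : FreeProfinite A), lift c (extend φ x) = lift (T c) x := by
    intro c x
    have : (lift c).comp (extend φ : FreeProfinite A →ₜ* FreeProfinite A) = lift (T c) := by
      refine hom_ext fun a => ?_
      rw [lift_of]
      change lift c (extend φ (eta A (FreeGroup.of a))) = _
      rw [extend_eta, lift_eta]
    exact DFunLike.congr_fun this x
  have hpow : ∀ (n : ℕ) (c : A → K) (x : FreeProfinite A),
      lift c ((extend φ ^ n) x) = lift (T^[n] c) x := by
    intro n
    induction n with
    | zero => intro c x; rfl
    | succ n ih =>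
      intro c x
      rw [pow_succ', Function.iterate_succ_apply, ← ih, ← hcomp]
      rfl
  -- Only finitely many values in a discrete group are involved, so some power of the extension
  -- already agrees with `ψ` on them.
  obtain ⟨n, hn⟩ : ∃ n : ℕ, ∀ (c : A → K) (a : A), lift c (ψ (of a)) = (T^[n] c) a := by
    have hopen : IsOpen {χ : ContEnd (FreeProfinite A) |
        ∀ (c : A → K) (a : A), lift c (χ (of a)) = lift c (ψ (of a))} := by
      simp only [Set.ofPred_forall]
      refine isOpen_iInter_of_finite fun c => isOpen_iInter_of_finite fun a => ?_
      have hev : Continuous fun χ : ContEnd (FreeProfinite A) => χ (of a) :=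
        (continuous_eval_const (F := C(FreeProfinite A, FreeProfinite A)) (of a)).comp
          (ContinuousMonoidHom.isInducing_toContinuousMap
            (FreeProfinite A) (FreeProfinite A)).continuous
      exact (isOpen_discrete {lift c (ψ (of a))}).preimage ((map_continuous (lift c)).comp hev)
    obtain ⟨_, hχ, n, -, rfl⟩ := mem_closure_iff.mp (omegaPower_mem_closure (extend φ)) _ hopen
      (fun _ _ => rfl)
    exact ⟨n, fun c a => by rw [← hχ c a, hpow, lift_of]⟩
  have hψc : ∀ (c : A → K) (x : FreeProfinite A), lift c (ψ x) = lift (T^[n] c) x := by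
    intro c x
    have : (lift c).comp (ψ : FreeProfinite A →ₜ* FreeProfinite A) = lift (T^[n] c) :=
      hom_ext fun a => (hn c a).trans (lift_of _ a).symm
    exact DFunLike.congr_fun this x
  -- Idempotence of `ψ` passes to the iterate; an injective idempotent map is the identity.
  have hidem : T^[n] (T^[n] c) = T^[n] c := by
    funext a
    have h : ψ (ψ (of a)) = ψ (of a) := DFunLike.congr_fun (omegaPower_mul_self (extend φ)) (of a)
    rw [← hn, ← hψc, h, hn]
  rw [hn, hφ.iterate n hidem]

end FreeProfinite

/-! ### Abelian quotients -/

/-- Letter counts are the coordinates on the abelianization. Hence precomposition with an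
endomorphism acts on homomorphisms to ℤ/p through the incidence matrix mod p. -/
theorem freeGroup_lift_eq_sum_letterCount {A : Type v} [Fintype A] [DecidableEq A] {R : Type w}
    [CommRing R] (c : A → Multiplicative R) (w : FreeGroup A) :
    (FreeGroup.lift c w).toAdd = ∑ b, ((letterCount b w).toAdd : R) * (c b).toAdd := by
  induction w using FreeGroup.induction_on with
  | C1 => simp
  | of a => simp [letterCount]
  | inv_of a h => simpa using h
  | mul x y hx hy => simp [hx, hy, add_mul, Finset.sum_add_distrib]

/-- Precomposition with `φ` is injective on homomorphisms to `ZMod p` if `p` does not divide the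
determinant of the incidence matrix. -/
theorem injective_precomp_of_not_dvd_det {A : Type v} [Fintype A] [DecidableEq A]
    (φ : FreeGroup A →* FreeGroup A) {p : ℕ} [Fact p.Prime]
    (hp : ¬ (p : ℤ) ∣ (incidenceMatrix φ).det) :
    Function.Injective fun (c : A → Multiplicative (ZMod p)) (a : A) =>
      FreeGroup.lift c (φ (FreeGroup.of a)) := by
  set M := (incidenceMatrix φ).map (Int.castRingHom (ZMod p)) with hM
  have hdet : IsUnit M.det := by
    rw [hM, ← RingHom.mapMatrix_apply, ← RingHom.map_det, isUnit_iff_ne_zero]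
    simpa [ZMod.intCast_zmod_eq_zero_iff_dvd] using hp
  have hinj : Function.Injective M.mulVec :=
    Matrix.mulVec_injective_of_isUnit ((Matrix.isUnit_iff_isUnit_det M).mpr hdet)
  intro c c' h
  have hmul : ∀ (c : A → Multiplicative (ZMod p)) (a : A),
      M.mulVec (fun b => (c b).toAdd) a = (FreeGroup.lift c (φ (FreeGroup.of a))).toAdd := by
    intro c a
    rw [freeGroup_lift_eq_sum_letterCount]
    rfl
  have h' : (fun b => (c b).toAdd) = fun b => (c' b).toAdd := by
    apply hinj
    funext a
    rw [hmul, hmul]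
    exact congrArg Multiplicative.toAdd (congrFun h a)
  exact funext fun b => Multiplicative.toAdd.injective (congrFun h' b)

/-! ### Homomorphisms to finite groups -/

/-- Continuous homomorphisms that kill the relators factor through a presented group. -/
theorem exists_factor_of_relators {P : ProfiniteGrp.{v}} {G : ProfiniteGrp.{u}} {R : Set P}
    {q : P →ₜ* G} (hq : Function.Surjective q)
    (hker : (q : P →* G).ker = closedNormalClosure R) {K : Type w} [Group K]
    [TopologicalSpace K] [T1Space K] (F : P →ₜ* K) (hF : ∀ r ∈ R, F r = 1) :
    ∃ F' : G →ₜ* K, ∀ x, F' (q x) = F x := by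
  have hle : (q : P →* G).ker ≤ (F : P →* K).ker := by
    rw [hker]
    refine Subgroup.topologicalClosure_minimal _ (Subgroup.normalClosure_le_normal hF) ?_
    exact isClosed_singleton.preimage (map_continuous F)
  let F' : G →* K := (q : P →* G).liftOfSurjective hq ⟨(F : P →* K), hle⟩
  have hF' : ∀ x, F' (q x) = F x := fun x =>
    MonoidHom.liftOfRightInverse_comp_apply (q : P →* G) _ (Function.rightInverse_surjInv hq)
      ⟨(F : P →* K), hle⟩ x
  refine ⟨⟨F', ?_⟩, hF'⟩
  have hquot : IsQuotientMap q :=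
    (map_continuous q).isClosedMap.isQuotientMap (map_continuous q) hq
  refine hquot.continuous_iff.mpr ?_
  convert map_continuous F using 1
  exact funext hF'

/-- The universal property of the basis `X` for finite discrete groups in any universe. -/
theorem existsUnique_extension_to_finite {G : ProfiniteGrp.{u}} {X : Set G}
    (hX : ∀ (H : ProfiniteGrp.{u}) (f : X → H), Tendsto f cofinite (𝓝 1) →
      ∃! F : G →ₜ* H, ∀ x : X, F (x : G) = f x)
    {K : Type w} [Group K] [Finite K] [TopologicalSpace K] [DiscreteTopology K] (f : X → K)
    (hf : Tendsto f cofinite (𝓝 1)) : ∃! F : G →ₜ* K, ∀ x : X, F (x : G) = f x := by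
  -- The basis property only tests groups in universe `u`; a finite group has a copy there.
  let : TopologicalSpace (Shrink.{u} K) := ⊥
  have : DiscreteTopology (Shrink.{u} K) := ⟨rfl⟩
  let e : Shrink.{u} K ≃* K := Shrink.mulEquiv
  let E₁ : Shrink.{u} K →ₜ* K := ⟨e.toMonoidHom, continuous_of_discreteTopology⟩
  let E₂ : K →ₜ* Shrink.{u} K := ⟨e.symm.toMonoidHom, continuous_of_discreteTopology⟩
  have hf' : Tendsto (fun x => E₂ (f x)) cofinite (𝓝 1) := by
    have := (map_continuous E₂).tendsto 1
    rw [map_one] at this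
    exact this.comp hf
  obtain ⟨F, hF, huniq⟩ := hX (ProfiniteGrp.of (Shrink.{u} K)) (fun x => E₂ (f x)) hf'
  refine ⟨E₁.comp F, fun x => ?_, fun F' hF' => ?_⟩
  · change e (F x) = f x
    rw [hF x]
    exact e.apply_symm_apply _
  · have h := huniq (E₂.comp F') fun x => by
      change e.symm (F' x) = e.symm (f x)
      rw [hF' x]
    rw [← h]
    ext y
    exact (e.apply_symm_apply _).symm

/-! ### Freeness of `ω`-presented groups -/

theorem HasProfinitePresentation.exists_hom {A : Type v} {G : ProfiniteGrp.{u}}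
    {R : Set (FreeProfinite A)} (hG : HasProfinitePresentation G A R) :
    ∃ q : FreeProfinite A →ₜ* G, Function.Surjective q ∧
      (q : FreeProfinite A →* G).ker = closedNormalClosure R := by
  obtain ⟨e⟩ := hG
  refine ⟨⟨e.symm.toMulEquiv.toMonoidHom.comp (QuotientGroup.mk' _),
    e.symm.continuous.comp continuous_quotient_mk'⟩,
    e.symm.surjective.comp (QuotientGroup.mk'_surjective _), ?_⟩
  ext x
  refine Iff.trans ?_ (QuotientGroup.eq_one_iff x)
  change e.symm (x : FreeProfinite A ⧸ closedNormalClosure R) = 1 ↔ _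
  exact map_eq_one_iff e.symm e.symm.injective

/-- If the idempotent power is trivial, the images of the letters form a basis. -/
theorem isFreeProfinite_of_omegaPower_eq_one {A : Type v} [Finite A]
    {φ : FreeGroup A →* FreeGroup A} {G : ProfiniteGrp.{u}} (hG : DefinesOmegaPresentation φ G)
    (hφ : omegaPower (FreeProfinite.extend φ) = 1) : IsFreeProfinite G := by
  obtain ⟨q, hq, hker⟩ := HasProfinitePresentation.exists_hom hG
  let X : Set G := Set.range fun a : A => q (FreeProfinite.of a)
  have : Finite X := Set.finite_range _
  refine ⟨X, by simp, fun H f _ => ?_⟩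
  -- Evaluating `f` at the image of each letter avoids having to know that distinct letters have
  -- distinct images.
  let F : FreeProfinite A →ₜ* H := FreeProfinite.lift fun a => f ⟨_, a, rfl⟩
  obtain ⟨F', hF'⟩ := exists_factor_of_relators hq hker F (by
    rintro _ ⟨a, rfl⟩
    rw [hφ]
    change F (FreeProfinite.of a * (FreeProfinite.of a)⁻¹) = 1
    rw [mul_inv_cancel, map_one])
  refine ⟨F', ?_, ?_⟩
  · rintro ⟨_, a, rfl⟩
    exact (hF' _).trans (FreeProfinite.lift_of _ a)
  · intro F'' hF''
    have : F''.comp q = F := FreeProfinite.hom_ext fun a =>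
      (hF'' ⟨_, a, rfl⟩).trans
        (FreeProfinite.lift_of (fun a => f ⟨_, a, rfl⟩) a).symm
    ext y
    obtain ⟨x, rfl⟩ := hq y
    rw [hF', ← this]
    rfl

/-! ### Counting homomorphisms to finite groups -/

section Counting

variable {A : Type v} {G : ProfiniteGrp.{u}} {q : FreeProfinite A →ₜ* G}

/-- A continuous homomorphism on a quotient of the free profinite group is determined by its
values on letters. -/
theorem injective_eval_letters (hq : Function.Surjective q) (K : Type w) [Group K]
    [TopologicalSpace K] [T2Space K] :
    Function.Injective fun (F : G →ₜ* K) (a : A) => F (q (FreeProfinite.of a)) := by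
  intro F F' h
  have hcomp : F.comp q = F'.comp q := FreeProfinite.hom_ext fun a => congrFun h a
  ext y
  obtain ⟨x, rfl⟩ := hq y
  exact DFunLike.congr_fun hcomp x

/-- A basis of a finitely generated profinite group is finite. -/
theorem finite_basis [Finite A] (hq : Function.Surjective q) {X : Set G}
    (hX : ∀ (H : ProfiniteGrp.{u}) (f : X → H), Tendsto f cofinite (𝓝 1) →
      ∃! F : G →ₜ* H, ∀ x : X, F (x : G) = f x) :
    Finite X := by
  classical
  let K := Multiplicative (ZMod 2)
  let : TopologicalSpace K := ⊥
  have : DiscreteTopology K := ⟨rfl⟩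
  have hfin : Finite (G →ₜ* K) := Finite.of_injective _ (injective_eval_letters hq K)
  -- Indicators of single points converge to 1, so they extend to distinct homomorphisms, of which
  -- there are finitely many.
  have hex : ∀ x : X, ∃ F : G →ₜ* K, ∀ y : X, F y = if y = x then Multiplicative.ofAdd 1 else 1 := by
    intro x
    refine (existsUnique_extension_to_finite hX _ ?_).exists
    refine tendsto_const_nhds.congr' ?_
    filter_upwards [(Set.finite_singleton x).compl_mem_cofinite] with y hy
    exact (if_neg fun h : y = x => hy h).symm
  choose F hF using hex
  refine Finite.of_injective F fun x y hxy => ?_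
  by_contra hne
  have h := hF x x
  rw [hxy, hF y x, if_neg hne, if_pos rfl] at h
  exact absurd h (by decide)

/-- The number of continuous homomorphisms to a finite group, in terms of a finite basis. -/
theorem card_hom_of_basis {X : Set G} [Finite X]
    (hX : ∀ (H : ProfiniteGrp.{u}) (f : X → H), Tendsto f cofinite (𝓝 1) →
      ∃! F : G →ₜ* H, ∀ x : X, F (x : G) = f x)
    (K : Type w) [Group K] [Finite K] [TopologicalSpace K]
    [DiscreteTopology K] : Nat.card (G →ₜ* K) = Nat.card K ^ Nat.card X := by
  rw [← Nat.card_fun]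
  refine Nat.card_eq_of_bijective (fun F x => F (x : G)) ?_
  rw [Function.bijective_iff_existsUnique]
  intro f
  simpa only [funext_iff] using existsUnique_extension_to_finite hX f (by simp)

end Counting

/-- If the incidence matrix is nonsingular and the group is free, then the idempotent power that
defines the presentation is the identity. -/
theorem omegaPower_extend_eq_one_of_isFreeProfinite {A : Type v} [Fintype A] [DecidableEq A]
    {φ : FreeGroup A →* FreeGroup A} {G : ProfiniteGrp.{u}} (hG : DefinesOmegaPresentation φ G)
    (hdet : (incidenceMatrix φ).det ≠ 0) (hfree : IsFreeProfinite G) :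
    omegaPower (FreeProfinite.extend φ) = 1 := by
  obtain ⟨X, -, hX⟩ := hfree
  obtain ⟨q, hq, hker⟩ := HasProfinitePresentation.exists_hom hG
  have : Finite X := finite_basis hq hX
  have hcard : Nat.card X = Nat.card A := by
    -- A prime larger than the absolute value of a nonzero determinant cannot divide it.
    obtain ⟨p, hp, hprime⟩ := Nat.exists_infinite_primes ((incidenceMatrix φ).det.natAbs + 1)
    have : Fact p.Prime := ⟨hprime⟩
    have hndvd : ¬ (p : ℤ) ∣ (incidenceMatrix φ).det := by
      rw [Int.natCast_dvd]
      intro h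
      have := Nat.le_of_dvd (Int.natAbs_pos.mpr hdet) h
      omega
    let K := Multiplicative (ZMod p)
    let : TopologicalSpace K := ⊥
    have : DiscreteTopology K := ⟨rfl⟩
    have hbij : Function.Bijective fun (F : G →ₜ* K) (a : A) => F (q (FreeProfinite.of a)) := by
      refine ⟨injective_eval_letters hq K, fun c => ?_⟩
      obtain ⟨F', hF'⟩ := exists_factor_of_relators hq hker (FreeProfinite.lift c) (by
        rintro _ ⟨a, rfl⟩
        rw [map_mul, map_inv, FreeProfinite.lift_omegaPower_of_injective φ
          (injective_precomp_of_not_dvd_det φ hndvd), FreeProfinite.lift_of, mul_inv_cancel])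
      exact ⟨F', funext fun a => (hF' _).trans (FreeProfinite.lift_of c a)⟩
    have h := Nat.card_eq_of_bijective _ hbij
    rw [card_hom_of_basis hX K, Nat.card_fun] at h
    have hK : Nat.card K = p := Nat.card_zmod p
    rw [hK] at h
    exact Nat.pow_right_injective hprime.two_le h
  refine FreeProfinite.hom_ext fun a => ?_
  set ψ := omegaPower (FreeProfinite.extend φ)
  change ψ (FreeProfinite.of a) = FreeProfinite.of a
  have hq1 : q (ψ (FreeProfinite.of a) * (FreeProfinite.of a)⁻¹) = 1 := by
    have : ψ (FreeProfinite.of a) * (FreeProfinite.of a)⁻¹ ∈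
        (q : FreeProfinite A →* G).ker := by
      rw [hker]
      exact Subgroup.le_topologicalClosure _ (Subgroup.subset_normalClosure ⟨a, rfl⟩)
    exact this
  rw [← mul_inv_eq_one]
  by_contra hne
  obtain ⟨U, hU⟩ := ProfiniteGrp.exist_openNormalSubgroup_sub_open_nhds_of_one
    (G := FreeProfinite A)
    (isOpen_compl_singleton (x := ψ (FreeProfinite.of a) * (FreeProfinite.of a)⁻¹))
    (by simpa using Ne.symm hne)
  have hUn : U.toSubgroup.Normal := U.isNormal'
  let K := FreeProfinite A ⧸ U.toSubgroup
  have hUf : U.toSubgroup.FiniteIndex := U.toFiniteIndexNormalSubgroup.isFiniteIndex'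
  have : Finite K := Subgroup.finite_quotient_of_finiteIndex
  have : DiscreteTopology K := QuotientGroup.discreteTopology U.isOpen'
  let π : FreeProfinite A →ₜ* K := ⟨QuotientGroup.mk' U.toSubgroup, continuous_quotient_mk'⟩
  -- Surjectivity comes from equal finite cardinalities; it makes `π`, which does not kill the
  -- relator, factor through `q`, which does.
  have hbij : Function.Bijective fun (F : G →ₜ* K) (a : A) => F (q (FreeProfinite.of a)) := by
    rw [Nat.bijective_iff_injective_and_card]
    exact ⟨injective_eval_letters hq K, by rw [card_hom_of_basis hX K, Nat.card_fun, hcard]⟩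
  obtain ⟨F, hF⟩ := hbij.2 fun a => π (FreeProfinite.of a)
  have hFπ : F.comp q = π := FreeProfinite.hom_ext fun a => congrFun hF a
  have hπ : π (ψ (FreeProfinite.of a) * (FreeProfinite.of a)⁻¹) = 1 := by
    rw [← hFπ]
    change F (q _) = 1
    rw [hq1, map_one]
  exact hU ((QuotientGroup.eq_one_iff _).mp hπ) rfl

theorem theorem4p1 {A : Type v} [Fintype A] [DecidableEq A] (φ : FreeGroup A →* FreeGroup A)
    (G : ProfiniteGrp.{u}) (hG : DefinesOmegaPresentation φ G)
    (hdet : (incidenceMatrix φ).det ≠ 0) :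
    IsFreeProfinite G ↔ Function.Bijective φ := by
  constructor
  · intro hfree
    exact FreeProfinite.bijective_of_isUnit_extend (isUnit_of_omegaPower_eq_one
      (omegaPower_extend_eq_one_of_isFreeProfinite hG hdet hfree))
  · intro hφ
    exact isFreeProfinite_of_omegaPower_eq_one hG
      (omegaPower_eq_one (FreeProfinite.isUnit_extend hφ))
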